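/- Let $k$ be a field. Let $\mathbf{Sm}_k$ be the category of smooth separated $k$-schemes of finite type, with all $k$-morphisms, and let $S_b$ be the class of birational morphisms in $\mathbf{Sm}_k$, that is, of the $k$-morphisms $f : X \to Y$ that restrict to an isomorphism from some dense open subscheme of $X$ onto some dense open subscheme of $Y$. Let $S_b^{-1}\mathbf{Sm}_k$ be the category obtained from $\mathbf{Sm}_k$ by formally inverting the morphisms in $S_b$. Then: (a) the projection $\mathbf{A}^1_k \to \operatorname{Spec} k$ becomes an isomorphism in $S_b^{-1}\mathbf{Sm}_k$; (b) more generally, for every smooth separated $k$-scheme $X$ of finite type, the projection $\mathbf{A}^1_X \to X$ becomes an isomorphism in $S_b^{-1}\mathbf{Sm}_k$. -/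

import Mathlib

open CategoryTheory AlgebraicGeometry

universe u

namespace BirationalLocalization

/-- The property of a morphism of schemes to be smooth, separated and of finite type
(that is, locally of finite type and quasi-compact). -/
def smoothSepFiniteType : MorphismProperty Scheme.{u} :=
  fun _ _ f => Smooth f ∧ IsSeparated f ∧ LocallyOfFiniteType f ∧ QuasiCompact f

/-- The category of smooth separated `k`-schemes of finite type; its morphisms are all
morphisms of `k`-schemes. -/
abbrev SmoothSchemes (k : Type u) [Field k] : Type (u + 1) :=
  (smoothSepFiniteType.{u}).Over ⊤ (Spec (CommRingCat.of k))

/-- The class of birational morphisms of smooth `k`-schemes: the `k`-morphisms `f : X ⟶ Y` that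
restrict to an isomorphism from a dense open subscheme of `X` onto a dense open subscheme
of `Y`. -/
def birationalMorphisms (k : Type u) [Field k] : MorphismProperty (SmoothSchemes k) :=
  fun X Y f => ∃ φ : Scheme.PartialIso X.left Y.left,
    φ.iso.hom ≫ φ.target.ι = φ.source.ι ≫ f.left

/-- The affine line over a scheme. -/
noncomputable abbrev affineLine (S : Scheme.{u}) : Scheme.{u} :=
  AffineSpace (ULift.{u} (Fin 1)) S

/-- The projection from the affine line over a scheme to that scheme. -/
noncomputable abbrev affineLineToBase (S : Scheme.{u}) : affineLine S ⟶ S :=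
  affineLine S ↘ S

theorem smooth_affineLineToBase (S : Scheme.{u}) : Smooth (affineLineToBase S) := by
  have hB : MorphismProperty.IsStableUnderBaseChange (@Smooth.{u}) :=
    smooth_isStableUnderBaseChange
  have hR : MorphismProperty.RespectsIso (@Smooth.{u}) := hB.respectsIso
  have hA : MorphismProperty.IsStableUnderBaseChangeAlong (@Smooth.{u})
      (Limits.terminal.from S) := ⟨fun sq hf => hB.of_isPullback sq hf⟩
  have h : Smooth (Limits.terminal.from
      (Spec (CommRingCat.of (MvPolynomial (ULift.{u} (Fin 1)) (ULift.{u} ℤ))))) := by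
    have := Limits.isIso_of_isTerminal specULiftZIsTerminal.{u} Limits.terminalIsTerminal
      (Limits.terminal.from _)
    rw [← Limits.terminal.comp_from (Spec.map (CommRingCat.ofHom MvPolynomial.C)),
      MorphismProperty.cancel_right_of_respectsIso (P := @Smooth),
      HasRingHomProperty.Spec_iff (P := @Smooth), RingHom.Smooth]
    have hM : Algebra.Smooth (ULift.{u} ℤ)
        (MvPolynomial (ULift.{u} (Fin 1)) (ULift.{u} ℤ)) := ⟨inferInstance, inferInstance⟩
    convert! hM
    exact Algebra.algebra_ext _ _ fun _ ↦ rfl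
  exact MorphismProperty.pullback_fst (P := @Smooth) (Limits.terminal.from S) _ h

/-- The affine line `𝔸¹_X` over a smooth separated `k`-scheme `X` of finite type, as an object
of the same category: its structure morphism is `𝔸¹_X ⟶ X ⟶ Spec k`. -/
noncomputable def affineLineOver {k : Type u} [Field k] (X : SmoothSchemes k) :
    SmoothSchemes k :=
  MorphismProperty.Over.mk ⊤ (affineLineToBase X.left ≫ X.hom) <| by
    obtain ⟨h₁, h₂, h₃, h₄⟩ := X.prop
    have := smooth_affineLineToBase X.left
    exact ⟨MorphismProperty.comp_mem @Smooth _ _ this h₁,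
      MorphismProperty.comp_mem @IsSeparated _ _ inferInstance h₂,
      MorphismProperty.comp_mem @LocallyOfFiniteType _ _ inferInstance h₃,
      MorphismProperty.comp_mem @QuasiCompact _ _ inferInstance h₄⟩

/-- The projection `𝔸¹_X ⟶ X`, as a morphism of smooth `k`-schemes. -/
noncomputable def projection {k : Type u} [Field k] (X : SmoothSchemes k) :
    affineLineOver X ⟶ X :=
  MorphismProperty.Over.homMk (affineLineToBase X.left) rfl trivial

/-- `Spec k` as a smooth `k`-scheme. -/
noncomputable def point (k : Type u) [Field k] : SmoothSchemes k :=
  MorphismProperty.Over.mk ⊤ (𝟙 (Spec (CommRingCat.of k)))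
    ⟨inferInstance, inferInstance, inferInstance, inferInstance⟩

end BirationalLocalization

namespace BirationalLocalization

open TopologicalSpace

/-! The chart `β : (u, v) ↦ (u, uv)` of the blow-up of the plane over `X` is birational, being
invertible over `u ≠ 0`, yet it contracts the line `i : t ↦ (0, t)`. With `p` the projection and `s`
the zero section of the line, `t ↦ (0, t)` and `t ↦ (0, 0)` thus agree after `β`, hence already in
the localization once `β` is inverted. Following both with `(u, v) ↦ v` makes `t ↦ 0` equal to the
identity, so `s` is a two-sided inverse of `p`. -/

/-- The standard coordinate on the affine line. -/
noncomputable abbrev affineLineCoord (S : Scheme.{u}) : Γ(affineLine S, ⊤) :=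
  AffineSpace.coord S (ULift.up 0)

/-- The morphism to the affine line over `S` given by a morphism to `S` and a function. -/
noncomputable def toAffineLine {T S : Scheme.{u}} (f : T ⟶ S) (a : Γ(T, ⊤)) : T ⟶ affineLine S :=
  AffineSpace.homOfVector f fun _ ↦ a

section

variable {R T S : Scheme.{u}}

theorem toAffineLine_base (f : T ⟶ S) (a : Γ(T, ⊤)) :
    toAffineLine f a ≫ affineLineToBase S = f :=
  AffineSpace.homOfVector_over _ _

theorem toAffineLine_base_assoc (f : T ⟶ S) (a : Γ(T, ⊤)) (g : S ⟶ R) :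
    toAffineLine f a ≫ affineLineToBase S ≫ g = f ≫ g := by
  rw [← Category.assoc, toAffineLine_base]

theorem toAffineLine_coord (f : T ⟶ S) (a : Γ(T, ⊤)) :
    (toAffineLine f a).appTop (affineLineCoord S) = a :=
  AffineSpace.homOfVector_appTop_coord _ _ _

theorem affineLine_hom_ext {f g : T ⟶ affineLine S}
    (hb : f ≫ affineLineToBase S = g ≫ affineLineToBase S)
    (hc : f.appTop (affineLineCoord S) = g.appTop (affineLineCoord S)) : f = g :=
  AffineSpace.hom_ext hb fun i ↦ by
    obtain ⟨i⟩ := i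
    obtain rfl := Subsingleton.elim i 0
    exact hc

theorem appTop_comp_apply (f : R ⟶ T) (g : T ⟶ S) (a : Γ(S, ⊤)) :
    (f ≫ g).appTop a = f.appTop (g.appTop a) := by
  rw [Scheme.Hom.comp_appTop, CommRingCat.comp_apply]

theorem comp_toAffineLine (g : R ⟶ T) (f : T ⟶ S) (a : Γ(T, ⊤)) :
    g ≫ toAffineLine f a = toAffineLine (g ≫ f) (g.appTop a) := by
  apply affineLine_hom_ext
  · rw [Category.assoc, toAffineLine_base, toAffineLine_base]
  · rw [appTop_comp_apply, toAffineLine_coord, toAffineLine_coord]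

theorem toAffineLine_self :
    toAffineLine (affineLineToBase S) (affineLineCoord S) = 𝟙 (affineLine S) := by
  apply affineLine_hom_ext
  · rw [toAffineLine_base, Category.id_comp]
  · rw [toAffineLine_coord, Scheme.Hom.id_appTop, CommRingCat.id_apply]

/-- Multiplication by a function on the base, as an endomorphism of the affine line. -/
noncomputable def scale (a : Γ(S, ⊤)) : affineLine S ⟶ affineLine S :=
  toAffineLine (affineLineToBase S) ((affineLineToBase S).appTop a * affineLineCoord S)

theorem toAffineLine_scale (f : T ⟶ S) (a : Γ(S, ⊤)) (b : Γ(T, ⊤)) :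
    toAffineLine f b ≫ scale a = toAffineLine f (f.appTop a * b) := by
  rw [scale, comp_toAffineLine, toAffineLine_base, map_mul, toAffineLine_coord,
    ← appTop_comp_apply, toAffineLine_base]

/-- A function is invertible where it does not vanish. -/
theorem isUnit_appTop_ι_of_le_basicOpen (a : Γ(S, ⊤)) (U : S.Opens) (hU : U ≤ S.basicOpen a) :
    IsUnit (U.ι.appTop a) := by
  have h : U.toScheme.basicOpen (U.ι.appTop a) = ⊤ := by
    rw [← Scheme.preimage_basicOpen_top, ← top_le_iff]
    exact fun x _ ↦ hU x.2
  -- A general `V` allows substitution of `V = ⊤`, after which the restriction map is the identity.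
  have key (V : U.toScheme.Opens) (i : V ⟶ ⊤) (hV : V = ⊤)
      (hu : IsUnit (U.toScheme.presheaf.map i.op (U.ι.appTop a))) : IsUnit (U.ι.appTop a) := by
    subst hV
    rwa [Subsingleton.elim i (𝟙 _), op_id, CategoryTheory.Functor.map_id,
      CommRingCat.id_apply] at hu
  exact key _ (homOfLE le_top) h
    (RingedSpace.isUnit_res_basicOpen (X := U.toScheme.toRingedSpace) (U.ι.appTop a))

/-- Multiplication by `a` is an automorphism of the part of the affine line lying over the open
subset where `a` is invertible. -/
theorem exists_scale_iso (a : Γ(S, ⊤)) :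
    ∃ e : (affineLineToBase S ⁻¹ᵁ S.basicOpen a).toScheme ≅
        (affineLineToBase S ⁻¹ᵁ S.basicOpen a).toScheme,
      e.hom ≫ (affineLineToBase S ⁻¹ᵁ S.basicOpen a).ι =
        (affineLineToBase S ⁻¹ᵁ S.basicOpen a).ι ≫ scale a := by
  let U := affineLineToBase S ⁻¹ᵁ S.basicOpen a
  let q : U.toScheme ⟶ S := U.ι ≫ affineLineToBase S
  let t : Γ(U.toScheme, ⊤) := U.ι.appTop (affineLineCoord S)
  have hι : U.ι = toAffineLine q t := by
    apply affineLine_hom_ext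
    · rw [toAffineLine_base]
    · rw [toAffineLine_coord]
  have ha : IsUnit (q.appTop a) := by
    rw [appTop_comp_apply]
    exact isUnit_appTop_ι_of_le_basicOpen _ _ (Scheme.preimage_basicOpen_top _ _).le
  obtain ⟨b, hb⟩ := ha.exists_right_inv
  have range (c : Γ(U.toScheme, ⊤)) : Set.range (toAffineLine q c) ⊆ Set.range U.ι := by
    rintro _ ⟨x, rfl⟩
    rw [Scheme.Opens.range_ι]
    change affineLineToBase S (toAffineLine q c x) ∈ S.basicOpen a
    rw [← Scheme.Hom.comp_apply, toAffineLine_base, Scheme.Hom.comp_apply]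
    exact x.2
  -- `m c` is `(x, t) ↦ (x, ct)`; the inverse of `m a` will be `m b`, where `ab = 1`.
  let m (c : Γ(U.toScheme, ⊤)) : U.toScheme ⟶ U.toScheme :=
    IsOpenImmersion.lift U.ι (toAffineLine q (c * t)) (range _)
  have hm (c) : m c ≫ U.ι = toAffineLine q (c * t) := IsOpenImmersion.lift_fac ..
  have hq (c) : m c ≫ q = q := by
    rw [← Category.assoc, hm, toAffineLine_base]
  have ht (c) : (m c).appTop t = c * t := by
    rw [← appTop_comp_apply, hm, toAffineLine_coord]
  have hqa (c) : (m c).appTop (q.appTop a) = q.appTop a := by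
    rw [← appTop_comp_apply, hq]
  -- `m c` fixes `a`, hence also its inverse.
  have hqb (c) : (m c).appTop b = b := by
    have h := congrArg (m c).appTop hb
    rw [map_mul, hqa, map_one] at h
    exact ha.mul_left_cancel (h.trans hb.symm)
  refine ⟨⟨m (q.appTop a), m b, ?_, ?_⟩, ?_⟩
  · rw [← cancel_mono U.ι, Category.assoc, hm, comp_toAffineLine, hq, map_mul, hqb, ht,
      Category.id_comp, hι, ← mul_assoc, mul_comm b, hb, one_mul]
  · rw [← cancel_mono U.ι, Category.assoc, hm, comp_toAffineLine, hq, map_mul, hqa, ht,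
      Category.id_comp, hι, ← mul_assoc, hb, one_mul]
  · change m _ ≫ U.ι = U.ι ≫ _
    rw [hm, hι, toAffineLine_scale]

variable (S) in
/-- The morphism `t ↦ (0, t)` from the affine line to the affine plane. -/
noncomputable def lineInPlane : affineLine S ⟶ affineLine (affineLine S) :=
  toAffineLine (toAffineLine (affineLineToBase S) 0) (affineLineCoord S)

variable (S) in
/-- The projection `(u, v) ↦ v` from the affine plane to the affine line. -/
noncomputable def planeToLine : affineLine (affineLine S) ⟶ affineLine S :=
  toAffineLine (affineLineToBase (affineLine S) ≫ affineLineToBase S)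
    (affineLineCoord (affineLine S))

theorem lineInPlane_base (f : S ⟶ T) :
    lineInPlane S ≫ affineLineToBase (affineLine S) ≫ affineLineToBase S ≫ f =
      affineLineToBase S ≫ f := by
  rw [lineInPlane, toAffineLine_base_assoc, toAffineLine_base_assoc]

theorem planeToLine_base (f : S ⟶ T) :
    planeToLine S ≫ affineLineToBase S ≫ f =
      affineLineToBase (affineLine S) ≫ affineLineToBase S ≫ f := by
  rw [planeToLine, toAffineLine_base_assoc, Category.assoc]

variable (S) in
theorem lineInPlane_planeToLine : lineInPlane S ≫ planeToLine S = 𝟙 (affineLine S) := by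
  rw [lineInPlane, planeToLine, comp_toAffineLine, toAffineLine_base_assoc, toAffineLine_base,
    toAffineLine_coord, toAffineLine_self]

variable (S) in
/-- The morphism `(u, v) ↦ (u, uv)` contracts the line `u = 0`. -/
theorem lineInPlane_scale :
    affineLineToBase S ≫ toAffineLine (𝟙 S) 0 ≫ lineInPlane S ≫ scale (affineLineCoord S) =
      lineInPlane S ≫ scale (affineLineCoord S) := by
  rw [lineInPlane, toAffineLine_scale, toAffineLine_coord, zero_mul]
  simp only [comp_toAffineLine, toAffineLine_base, Category.comp_id, map_zero]

end

/-- Under `𝔸¹_k ≅ Spec k[T]` the coordinate is the variable `T`. -/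
theorem affineLineCoord_ne_zero (k : Type u) [Field k] :
    affineLineCoord (Spec (CommRingCat.of k)) ≠ 0 := by
  intro h
  have hX := AffineSpace.SpecIso_inv_appTop_coord (n := ULift.{u} (Fin 1)) (CommRingCat.of k)
    (ULift.up 0)
  rw [show AffineSpace.coord (Spec (CommRingCat.of k)) (ULift.up (0 : Fin 1)) = 0 from h,
    map_zero] at hX
  have hX0 := congrArg
    (Scheme.ΓSpecIso (CommRingCat.of (MvPolynomial (ULift.{u} (Fin 1)) k))).hom hX
  rw [map_zero, ← CommRingCat.comp_apply, Iso.inv_hom_id, CommRingCat.id_apply] at hX0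
  exact MvPolynomial.X_ne_zero (R := k) (ULift.up (0 : Fin 1)) hX0.symm

variable {k : Type u} [Field k]

/-- `X` may be reducible, so density is proved on the integral scheme `𝔸¹_k` and pulled back along
`𝔸¹_X ⟶ 𝔸¹_k`, which is open as a base change of the smooth `X ⟶ Spec k`. -/
theorem dense_basicOpen_affineLineCoord (X : SmoothSchemes k) :
    Dense ((affineLine X.left).basicOpen (affineLineCoord X.left) : Set (affineLine X.left)) := by
  have hX : Smooth X.hom := X.prop.1
  let f : affineLine X.left ⟶ affineLine (Spec (CommRingCat.of k)) :=
    AffineSpace.map _ X.hom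
  have hf : UniversallyOpen f :=
    MorphismProperty.of_isPullback (P := @UniversallyOpen) (AffineSpace.isPullback_map X.hom).flip
      inferInstance
  have hc : f.appTop (affineLineCoord _) = affineLineCoord X.left :=
    AffineSpace.map_appTop_coord _ _
  have hd : Dense ((affineLine (Spec (CommRingCat.of k))).basicOpen (affineLineCoord _) :
      Set (affineLine (Spec (CommRingCat.of k)))) := by
    refine (Opens.isOpen _).dense ?_
    rw [Set.nonempty_iff_ne_empty]
    intro h
    exact affineLineCoord_ne_zero k ((basicOpen_eq_bot_iff _).mp (Opens.ext h))
  rw [← hc, ← Scheme.preimage_basicOpen_top]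
  exact hd.preimage f.isOpenMap

/-- The chart `(u, v) ↦ (u, uv)` of the blow-up of the affine plane over `X`. -/
noncomputable def blowupChart (X : SmoothSchemes k) :
    affineLineOver (affineLineOver X) ⟶ affineLineOver (affineLineOver X) :=
  MorphismProperty.Over.homMk (scale (affineLineCoord X.left))
    (toAffineLine_base_assoc _ _ (affineLineToBase X.left ≫ X.hom)) trivial

/-- Source and target of the partial isomorphism are both the locus `u ≠ 0`, dense as a preimage
under the open projection `(u, v) ↦ u`. -/
theorem blowupChart_mem (X : SmoothSchemes k) :
    birationalMorphisms k (blowupChart X) := by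
  obtain ⟨e, he⟩ := exists_scale_iso (affineLineCoord X.left)
  have hd := (dense_basicOpen_affineLineCoord X).preimage
    (AffineSpace.isOpenMap_over (n := ULift.{u} (Fin 1)) (affineLine X.left))
  exact ⟨⟨_, hd, _, hd, e⟩, he⟩

/-- The zero section of the affine line over `X`. -/
noncomputable def zeroSection (X : SmoothSchemes k) : X ⟶ affineLineOver X :=
  MorphismProperty.Over.homMk (toAffineLine (𝟙 X.left) 0)
    ((toAffineLine_base_assoc (𝟙 X.left) 0 X.hom).trans (Category.id_comp X.hom)) trivial

/-- The inclusion `t ↦ (0, t)` of the line contracted by the chart of the blow-up. -/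
noncomputable def exceptionalLine (X : SmoothSchemes k) :
    affineLineOver X ⟶ affineLineOver (affineLineOver X) :=
  MorphismProperty.Over.homMk (lineInPlane X.left) (lineInPlane_base X.hom) trivial

/-- The projection `(u, v) ↦ v` from the affine plane to the affine line. -/
noncomputable def secondCoordinate (X : SmoothSchemes k) :
    affineLineOver (affineLineOver X) ⟶ affineLineOver X :=
  MorphismProperty.Over.homMk (planeToLine X.left) (planeToLine_base X.hom) trivial

theorem zeroSection_projection (X : SmoothSchemes k) :
    zeroSection X ≫ projection X = 𝟙 X :=
  MorphismProperty.Over.Hom.ext (toAffineLine_base _ _)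

theorem exceptionalLine_secondCoordinate (X : SmoothSchemes k) :
    exceptionalLine X ≫ secondCoordinate X = 𝟙 (affineLineOver X) :=
  MorphismProperty.Over.Hom.ext (lineInPlane_planeToLine X.left)

theorem exceptionalLine_blowupChart (X : SmoothSchemes k) :
    projection X ≫ zeroSection X ≫ exceptionalLine X ≫ blowupChart X =
      exceptionalLine X ≫ blowupChart X :=
  MorphismProperty.Over.Hom.ext (lineInPlane_scale X.left)

theorem isIso_Q_map_projection (X : SmoothSchemes k) :
    IsIso ((birationalMorphisms k).Q.map (projection X)) := by
  let Q := (birationalMorphisms k).Q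
  have hb : IsIso (Q.map (blowupChart X)) :=
    (birationalMorphisms k).Q_inverts _ (blowupChart_mem X)
  -- The two lines agree after `β`, which is now cancellable.
  have h₁ : Q.map (projection X ≫ zeroSection X ≫ exceptionalLine X) =
      Q.map (exceptionalLine X) := by
    rw [← cancel_mono (Q.map (blowupChart X)), ← Q.map_comp, ← Q.map_comp, Category.assoc,
      Category.assoc, exceptionalLine_blowupChart]
  have h₂ := congrArg (· ≫ Q.map (secondCoordinate X)) h₁
  rw [← Q.map_comp, ← Q.map_comp, Category.assoc, Category.assoc,
    exceptionalLine_secondCoordinate, Category.comp_id] at h₂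
  refine ⟨Q.map (zeroSection X), ?_, ?_⟩
  · rw [← Q.map_comp, h₂, Q.map_id]
  · rw [← Q.map_comp, zeroSection_projection, Q.map_id]

end BirationalLocalization

theorem mainTheorem6 (k : Type u) [Field k] :
    IsIso ((BirationalLocalization.birationalMorphisms k).Q.map
      (BirationalLocalization.projection (BirationalLocalization.point k))) ∧
    ∀ X : BirationalLocalization.SmoothSchemes k,
      IsIso ((BirationalLocalization.birationalMorphisms k).Q.map
        (BirationalLocalization.projection X)) :=
  ⟨BirationalLocalization.isIso_Q_map_projection _, BirationalLocalization.isIso_Q_map_projection⟩
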